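/- **Pointwise damping for $d\ge 5$.** Let $d\ge 5$, let $a\in C^\infty(0,\infty)$ be positive and (weakly) increasing, and let $t_0>0$. Put $\tau(t)=\int_{t_0}^t a(s)^{-2}\,ds$ for $t\ge t_0$, and let $T$ be the inverse of $t\mapsto\tau(t)$ on its range. Let $\mu:\mathbb R^d\to[0,\infty)$ be analytic with $\int_{\mathbb R^d}\mu(w)\,dw=1$, write $\hat\mu(\xi)=\int_{\mathbb R^d}\mu(w)e^{-i\xi\cdot w}\,dw$, and suppose $|\hat\mu(\xi)|\le C_0e^{-\theta_0|\xi|}$ for all $\xi\in\mathbb R^d$, with some constants $C_0$ and $\theta_0>0$. Assume the adapted Penrose condition: for some $\kappa>0$, $$\inf_{k\in\mathbb Z^d\setminus\{0\}}\ \inf_{\operatorname{Re}\lambda\ge 0}\left|1-4\pi\,a(t_0)^{-(d-4)}\int_0^\infty e^{-\lambda s}\,s\,|\hat\mu(sk)|\,ds\right|\ \ge\ \kappa .$$ Then there are constants $\theta_1>0$, $C>0$ and, for each $k\in\mathbb Z^d\setminus\{0\}$, a continuous nonnegative function $R_k$ on $\{(\tau,\tilde\tau):\tau\ge\tilde\tau\ge0\}$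 with the following properties. It is the resolvent kernel of $K_k(\tau,\tilde\tau)=4\pi\,a(t_0)^{4-d}(\tau-\tilde\tau)\,|\hat\mu(k(\tau-\tilde\tau))|$, that is, $$R_k(\tau,\tilde\tau)=K_k(\tau,\tilde\tau)+\int_{\tilde\tau}^{\tau}K_k(\tau,s)\,R_k(s,\tilde\tau)\,ds\qquad(\tau\ge\tilde\tau\ge0).$$ It satisfies, with $C$ and $\theta_1$ independent of $k$, $$|R_k(\tau,\tilde\tau)|\le C\,e^{-\theta_1|k|(\tau-\tilde\tau)}\qquad(\tau\ge\tilde\tau\ge0).$$ Moreover, for either sign $\epsilon_F\in\{1,-1\}$, every $t\ge t_0$, and all continuous $\hat\rho_k,\hat S_k:[0,\tau(t)]\to\mathbb C$ that satisfy on $[0,\tau(t)]$ the equation $$\hat\rho_k(\tau)=\hat S_k(\tau)+4\pi\,\epsilon_F\int_0^\tau(\tau-\tilde\tau)\,\hat\mu(k(\tau-\tilde\tau))\,\hat\rho_k(\tilde\tau)\,a(T(\tilde\tau))^{4-d}\,d\tilde\tau ,$$ one has, for all $\tau\in[0,\tau(t)]$, $$|\hat\rho_k(\tau)|\le|\hat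 S_k(\tau)|+\int_0^\tau R_k(\tau,\tilde\tau)\,|\hat S_k(\tilde\tau)|\,d\tilde\tau .$$ -/

import Mathlib

open MeasureTheory Set
open scoped ContDiff

noncomputable section

/-- The frequency `k ∈ ℤ^d`, viewed as a vector of the Euclidean space `ℝ^d`. -/
def freqVec {d : ℕ} (k : Fin d → ℤ) : EuclideanSpace ℝ (Fin d) :=
  WithLp.toLp 2 (fun i => (k i : ℝ))

/-- Fourier transform with the non-unitary convention `μ̂(ξ) = ∫ μ(w) e^{-i ξ·w} dw`. -/
def fourierHat {d : ℕ} (μ : EuclideanSpace ℝ (Fin d) → ℝ) (ξ : EuclideanSpace ℝ (Fin d)) : ℂ :=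
  ∫ w, (μ w : ℂ) * Complex.exp (-(Complex.I * ((inner ℝ ξ w : ℝ) : ℂ)))

/-- Admissible scale factors: smooth, positive and (weakly) increasing on `(0, ∞)`. -/
structure IsScaleFactor (a : ℝ → ℝ) : Prop where
  smooth : ContDiffOn ℝ ∞ a (Ioi 0)
  pos : ∀ t, 0 < t → 0 < a t
  mono : MonotoneOn a (Ioi 0)

/-- The rescaled time `τ(t) = ∫_{t₀}^t a(s)^{-2} ds`. -/
def tauOf (a : ℝ → ℝ) (t₀ t : ℝ) : ℝ :=
  ∫ s in t₀..t, (a s) ^ (-2 : ℤ)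

/-- The inverse `T` of `t ↦ τ(t)`, `t ∈ [t₀, ∞)`, on its range. -/
def timeOf (a : ℝ → ℝ) (t₀ : ℝ) : ℝ → ℝ :=
  Function.invFunOn (tauOf a t₀) (Ici t₀)

/-- Admissible spatially homogeneous backgrounds `f₀(t,x,v) = μ(a(t) v)`: the profile `μ` is
analytic, nonnegative, of unit mass, and its Fourier transform decays like `e^{-θ₀|ξ|}`.
No bounds on derivatives of `μ̂` are required, so that the Poisson background
`μ̂(ξ) = e^{-θ₀|ξ|}`, whose transform is not differentiable at `0`, is included. -/
structure IsBackground {d : ℕ} (μ : EuclideanSpace ℝ (Fin d) → ℝ) (C₀ θ₀ : ℝ) : Prop where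
  analytic : AnalyticOnNhd ℝ μ univ
  nonneg : ∀ w, 0 ≤ μ w
  integrable : Integrable μ
  mass : ∫ w, μ w = 1
  decay : ∀ ξ, ‖fourierHat μ ξ‖ ≤ C₀ * Real.exp (-θ₀ * ‖ξ‖)

/-- The adapted Penrose condition in dimension `d ≥ 5` with initial time `t₀` and parameter `κ`:
`inf_{k ≠ 0} inf_{Re λ ≥ 0} |1 - 4π a(t₀)^{-(d-4)} ∫₀^∞ e^{-λ s} s |μ̂(s k)| ds| ≥ κ`. -/
def AdaptedPenrose {d : ℕ} (μ : EuclideanSpace ℝ (Fin d) → ℝ) (a : ℝ → ℝ) (t₀ κ : ℝ) : Prop :=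
  ∀ k : Fin d → ℤ, k ≠ 0 → ∀ z : ℂ, 0 ≤ z.re →
    κ ≤ ‖(1 : ℂ) - ((4 * Real.pi * (a t₀) ^ (-((d : ℤ) - 4)) : ℝ) : ℂ) *
      ∫ s in Ioi (0 : ℝ), Complex.exp (-z * (s : ℂ)) *
        ((s * ‖fourierHat μ (s • freqVec k)‖ : ℝ) : ℂ)‖

/-- `ρ` solves, on `[0, τmax]`, the Volterra equation of the `k`-th density mode with source `S`:
`ρ(τ) = S(τ) + 4π ε ∫₀^τ (τ-σ) μ̂(k(τ-σ)) ρ(σ) a(T(σ))^{4-d} dσ`. -/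
def SolvesVolterra {d : ℕ} (μ : EuclideanSpace ℝ (Fin d) → ℝ) (a : ℝ → ℝ) (t₀ ε : ℝ)
    (k : Fin d → ℤ) (τmax : ℝ) (S ρ : ℝ → ℂ) : Prop :=
  ∀ τ ∈ Icc (0 : ℝ) τmax,
    ρ τ = S τ + ((4 * Real.pi * ε : ℝ) : ℂ) *
      ∫ σ in (0 : ℝ)..τ, ((τ - σ : ℝ) : ℂ) * fourierHat μ ((τ - σ) • freqVec k) * ρ σ *
        (((a (timeOf a t₀ σ)) ^ ((4 : ℤ) - (d : ℤ)) : ℝ) : ℂ)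

/-- The nonnegative convolution kernel
`K_k(τ,σ) = 4π a(t₀)^{4-d} (τ-σ) |μ̂(k(τ-σ))|`, used for `τ ≥ σ ≥ 0`. -/
def majorantKernel {d : ℕ} (μ : EuclideanSpace ℝ (Fin d) → ℝ) (a : ℝ → ℝ) (t₀ : ℝ)
    (k : Fin d → ℤ) (τ σ : ℝ) : ℝ :=
  4 * Real.pi * (a t₀) ^ ((4 : ℤ) - (d : ℤ)) * ((τ - σ) * ‖fourierHat μ ((τ - σ) • freqVec k)‖)

/-- `R` is the continuous resolvent kernel of the Volterra kernel `K` on `τ ≥ σ ≥ 0`: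
`R(τ,σ) = K(τ,σ) + ∫_σ^τ K(τ,s) R(s,σ) ds`. -/
structure IsResolventKernel (K R : ℝ → ℝ → ℝ) : Prop where
  continuousOn : ContinuousOn (fun p : ℝ × ℝ => R p.1 p.2) {p | 0 ≤ p.2 ∧ p.2 ≤ p.1}
  resolvent_eq : ∀ τ σ, 0 ≤ σ → σ ≤ τ → R τ σ = K τ σ + ∫ s in σ..τ, K τ s * R s σ

end

/-!
For `k ≠ 0` the kernel is of convolution type with nonnegative profile `K` (`majorantProfile`).
The Laplace transform of `K` at real `x ≥ 0` is continuous, tends to `0` as `x → ∞`, and by the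
Penrose condition stays at distance `κ` from `1`; by the intermediate value theorem the `L¹` norm
of `K` is at most `1 - κ` (`integral_le_of_laplace_ne_one`). Since `|k| ≥ 1`, the decay of `μ̂`
shows that the weight `e^{θ|k|u}` changes this norm by `O(θ)`, uniformly in `k`
(`integral_mul_exp_le`), so for a small `θ` the weighted norm is at most `1 - κ/2`. Hence the
Neumann series `K + K * K + …` converges geometrically in the weighted sup norm, and its sum is a
continuous nonnegative resolvent with the decay `e^{-θ|k|u}` (`exists_convolution_resolvent`).

The pointwise bound is a comparison principle (`le_add_resolvent_of_le_volterra`). As `a` is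
increasing and `4 - d < 0`, `‖ρ‖` is a subsolution of `x = ‖S‖ + K * x`
(`SolvesVolterra.norm_le`), whereas `‖S‖ + r * ‖S‖` is a solution by the resolvent equation and
the associativity of causal convolution. Their difference `z` satisfies `z ≤ K * z`, which at a
positive maximum would contradict that `K` has `L¹` norm less than one.
-/

/-! ### Causal convolution -/

/-- The causal convolution `(f * g)(t) = ∫₀ᵗ f(t - s) g(s) ds`. It is used for `t ≥ 0`; for
functions vanishing on `(-∞, 0]` it vanishes there as well. -/
noncomputable def volterraConv (f g : ℝ → ℝ) (t : ℝ) : ℝ :=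
  ∫ s in (0 : ℝ)..t, f (t - s) * g s

lemma continuous_volterraConv {f g : ℝ → ℝ} (hf : Continuous f) (hg : Continuous g) :
    Continuous (volterraConv f g) :=
  intervalIntegral.continuous_parametric_intervalIntegral_of_continuous
    (f := fun t s => f (t - s) * g s) (by unfold Function.uncurry; fun_prop) continuous_id

lemma volterraConv_of_nonpos {f g : ℝ → ℝ} (hg : ∀ u ≤ 0, g u = 0) {t : ℝ} (ht : t ≤ 0) :
    volterraConv f g t = 0 := by
  unfold volterraConv
  rw [intervalIntegral.integral_congr (g := fun _ => 0)]
  · simp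
  · intro s hs
    rw [uIcc_of_ge ht] at hs
    simp [hg s hs.2]

lemma volterraConv_nonneg {f g : ℝ → ℝ} (hf : ∀ u, 0 ≤ f u) (hg : ∀ u, 0 ≤ g u) {t : ℝ}
    (ht : 0 ≤ t) : 0 ≤ volterraConv f g t :=
  intervalIntegral.integral_nonneg ht fun s _ => mul_nonneg (hf _) (hg s)

lemma intervalIntegral_shift_eq_volterraConv (f g : ℝ → ℝ) (t u : ℝ) :
    ∫ s in u..t, f (t - s) * g (s - u) = volterraConv f g (t - u) := by
  have h := intervalIntegral.integral_comp_sub_right (fun v => f (t - u - v) * g v) u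
    (a := u) (b := t)
  rw [sub_self] at h
  rw [volterraConv, ← h]
  refine intervalIntegral.integral_congr fun s _ => ?_
  rw [sub_sub_sub_cancel_right]

lemma volterraConv_assoc {f g h : ℝ → ℝ} (hf : Continuous f) (hg : Continuous g)
    (hh : Continuous h) (hg0 : ∀ u ≤ 0, g u = 0) {t : ℝ} (ht : 0 ≤ t) :
    volterraConv f (volterraConv g h) t = volterraConv (volterraConv f g) h t := by
  -- Since `g` vanishes on `(-∞, 0]`, the triangle `u ≤ s ≤ t` may be replaced by a square.
  have h1 : volterraConv f (volterraConv g h) t =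
      ∫ s in (0 : ℝ)..t, ∫ u in (0 : ℝ)..t, f (t - s) * (g (s - u) * h u) := by
    refine intervalIntegral.integral_congr fun s hs => ?_
    rw [uIcc_of_le ht] at hs
    rw [intervalIntegral.integral_const_mul]
    congr 1
    have hc : Continuous fun u => g (s - u) * h u := by fun_prop
    rw [← intervalIntegral.integral_add_adjacent_intervals (hc.intervalIntegrable 0 s)
      (hc.intervalIntegrable s t), intervalIntegral.integral_congr (a := s) (g := fun _ => 0)]
    · simp [volterraConv]
    · intro u hu
      rw [uIcc_of_le hs.2] at hu
      simp [hg0 (s - u) (by linarith [hu.1])]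
  have h2 : volterraConv (volterraConv f g) h t =
      ∫ u in (0 : ℝ)..t, ∫ s in (0 : ℝ)..t, f (t - s) * (g (s - u) * h u) := by
    refine intervalIntegral.integral_congr fun u hu => ?_
    rw [uIcc_of_le ht] at hu
    have hc : Continuous fun s => f (t - s) * g (s - u) := by fun_prop
    simp only [← mul_assoc]
    rw [intervalIntegral.integral_mul_const, ← intervalIntegral_shift_eq_volterraConv,
      ← intervalIntegral.integral_add_adjacent_intervals (hc.intervalIntegrable 0 u)
      (hc.intervalIntegrable u t),
      intervalIntegral.integral_congr (a := 0) (b := u) (g := fun _ => 0)]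
    · simp
    · intro s hs
      rw [uIcc_of_le hu.1] at hs
      simp [hg0 (s - u) (by linarith [hs.2])]
  rw [h1, h2]
  refine intervalIntegral_intervalIntegral_swap ?_
  have hc : Continuous (Function.uncurry fun s u => f (t - s) * (g (s - u) * h u)) := by
    unfold Function.uncurry
    fun_prop
  exact (hc.continuousOn.integrableOn_compact (isCompact_uIcc.prod isCompact_uIcc)).mono_set
    (prod_mono uIoc_subset_uIcc uIoc_subset_uIcc)

lemma volterraConv_add_right {f g h : ℝ → ℝ} (hf : Continuous f) (hg : Continuous g)
    (hh : Continuous h) (t : ℝ) :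
    volterraConv f (fun u => g u + h u) t = volterraConv f g t + volterraConv f h t := by
  unfold volterraConv
  rw [← intervalIntegral.integral_add (Continuous.intervalIntegrable (by fun_prop) _ _)
    (Continuous.intervalIntegrable (by fun_prop) _ _)]
  simp only [mul_add]

lemma volterraConv_add_left {f g h : ℝ → ℝ} (hf : Continuous f) (hg : Continuous g)
    (hh : Continuous h) (t : ℝ) :
    volterraConv (fun u => f u + g u) h t = volterraConv f h t + volterraConv g h t := by
  unfold volterraConv
  rw [← intervalIntegral.integral_add (Continuous.intervalIntegrable (by fun_prop) _ _)
    (Continuous.intervalIntegrable (by fun_prop) _ _)]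
  simp only [add_mul]

/-! ### Resolvents of convolution kernels -/

/-- The terms `K, K * K, K * K * K, …` of the Neumann series of the resolvent. -/
noncomputable def resolventTerm (K : ℝ → ℝ) : ℕ → ℝ → ℝ
  | 0 => K
  | n + 1 => volterraConv K (resolventTerm K n)

lemma continuous_resolventTerm {K : ℝ → ℝ} (hK : Continuous K) (n : ℕ) :
    Continuous (resolventTerm K n) := by
  induction n with
  | zero => exact hK
  | succ n ih => exact continuous_volterraConv hK ih

lemma resolventTerm_of_nonpos {K : ℝ → ℝ} (hK0 : ∀ u ≤ 0, K u = 0) (n : ℕ) :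
    ∀ u ≤ 0, resolventTerm K n u = 0 := by
  induction n with
  | zero => exact hK0
  | succ n ih => exact fun u hu => volterraConv_of_nonpos ih hu

lemma resolventTerm_nonneg {K : ℝ → ℝ} (hK0 : ∀ u ≤ 0, K u = 0) (hKn : ∀ u, 0 ≤ K u) (n : ℕ) :
    ∀ u, 0 ≤ resolventTerm K n u := by
  induction n with
  | zero => exact hKn
  | succ n ih =>
    intro u
    rcases le_total u 0 with hu | hu
    · exact (resolventTerm_of_nonpos hK0 (n + 1) u hu).ge
    · exact volterraConv_nonneg hKn ih hu

/-- Young's inequality `L¹ * L^∞ ⊆ L^∞`, applied to functions weighted by `e^{θu}`. -/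
lemma resolventTerm_le {K : ℝ → ℝ} (hK : Continuous K) (hKn : ∀ u, 0 ≤ K u) {M θ q : ℝ}
    (hKM : ∀ u, 0 ≤ u → K u ≤ M * Real.exp (-θ * u)) (hM : 0 ≤ M) (hq0 : 0 ≤ q)
    (hKq : ∀ u, 0 ≤ u → ∫ v in (0 : ℝ)..u, K v * Real.exp (θ * v) ≤ q) (n : ℕ) :
    ∀ u, 0 ≤ u → resolventTerm K n u ≤ M * q ^ n * Real.exp (-θ * u) := by
  induction n with
  | zero => simpa [resolventTerm] using hKM
  | succ n ih =>
    intro u hu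
    have hc := continuous_resolventTerm hK n
    calc resolventTerm K (n + 1) u
        ≤ ∫ s in (0 : ℝ)..u, M * q ^ n * Real.exp (-θ * u) *
            (K (u - s) * Real.exp (θ * (u - s))) := by
          refine intervalIntegral.integral_mono_on hu
            (Continuous.intervalIntegrable (by fun_prop) _ _)
            (Continuous.intervalIntegrable (by fun_prop) _ _) fun s hs => ?_
          have he : Real.exp (-θ * s) = Real.exp (-θ * u) * Real.exp (θ * (u - s)) := by
            rw [← Real.exp_add]
            congr 1
            ring
          calc K (u - s) * resolventTerm K n s
              ≤ K (u - s) * (M * q ^ n * Real.exp (-θ * s)) :=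
                mul_le_mul_of_nonneg_left (ih s hs.1) (hKn _)
            _ = _ := by
                rw [he]
                ring
      _ = M * q ^ n * Real.exp (-θ * u) * ∫ v in (0 : ℝ)..u, K v * Real.exp (θ * v) := by
          rw [intervalIntegral.integral_const_mul,
            intervalIntegral.integral_comp_sub_left (fun v => K v * Real.exp (θ * v)) u]
          simp
      _ ≤ M * q ^ n * Real.exp (-θ * u) * q :=
          mul_le_mul_of_nonneg_left (hKq u hu) (by positivity)
      _ = M * q ^ (n + 1) * Real.exp (-θ * u) := by ring

/-- The resolvent of a nonnegative causal convolution kernel whose `L¹` norm with the weight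
`e^{θu}` is at most `q < 1` inherits the exponential decay of the kernel. -/
lemma exists_convolution_resolvent {K : ℝ → ℝ} (hK : Continuous K) (hK0 : ∀ u ≤ 0, K u = 0)
    (hKn : ∀ u, 0 ≤ K u) {M θ q : ℝ} (hθ : 0 ≤ θ)
    (hKM : ∀ u, 0 ≤ u → K u ≤ M * Real.exp (-θ * u)) (hM : 0 ≤ M) (hq0 : 0 ≤ q) (hq : q < 1)
    (hKq : ∀ u, 0 ≤ u → ∫ v in (0 : ℝ)..u, K v * Real.exp (θ * v) ≤ q) :
    ∃ r : ℝ → ℝ, Continuous r ∧ (∀ u ≤ 0, r u = 0) ∧ (∀ u, 0 ≤ r u) ∧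
      (∀ u, 0 ≤ u → r u ≤ M / (1 - q) * Real.exp (-θ * u)) ∧
      ∀ u, 0 ≤ u → r u = K u + volterraConv K r u := by
  have hc := continuous_resolventTerm hK
  have hn := resolventTerm_nonneg hK0 hKn
  have h0 := resolventTerm_of_nonpos hK0
  have hle := resolventTerm_le hK hKn hKM hM hq0 hKq
  have hgeo : HasSum (fun n => M * q ^ n) (M / (1 - q)) := by
    simpa [div_eq_mul_inv] using (hasSum_geometric_of_lt_one hq0 hq).mul_left M
  have hbd : ∀ n u, ‖resolventTerm K n u‖ ≤ M * q ^ n := by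
    intro n u
    rw [Real.norm_of_nonneg (hn n u)]
    rcases le_total u 0 with hu | hu
    · rw [h0 n u hu]
      positivity
    · refine (hle n u hu).trans (mul_le_of_le_one_right (by positivity) ?_)
      exact Real.exp_le_one_iff.2 (by nlinarith)
  have hsum : ∀ u, Summable fun n => resolventTerm K n u := fun u =>
    Summable.of_norm_bounded hgeo.summable fun n => hbd n u
  have hrc : Continuous fun u => ∑' n, resolventTerm K n u :=
    continuous_tsum hc hgeo.summable hbd
  refine ⟨fun u => ∑' n, resolventTerm K n u, hrc, fun u hu => ?_, fun u => ?_, fun u hu => ?_,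
    fun u hu => ?_⟩
  · simp [h0 _ u hu]
  · exact tsum_nonneg fun n => hn n u
  · exact hasSum_le (fun n => hle n u hu) (hsum u).hasSum (hgeo.mul_right _)
  · have h := intervalIntegral.hasSum_integral_of_dominated_convergence (μ := volume)
      (a := 0) (b := u) (F := fun n s => K (u - s) * resolventTerm K n s)
      (f := fun s => K (u - s) * ∑' n, resolventTerm K n s)
      (fun n s => K (u - s) * (M * q ^ n))
      (fun n => (Continuous.aestronglyMeasurable (by fun_prop)))
      (fun n => .of_forall fun s _ => by
        rw [norm_mul, Real.norm_of_nonneg (hKn _)]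
        exact mul_le_mul_of_nonneg_left (hbd n s) (hKn _))
      (.of_forall fun s _ => hgeo.summable.mul_left _)
      (by
        simp only [tsum_mul_left]
        exact Continuous.intervalIntegrable (by fun_prop) _ _)
      (.of_forall fun s _ => (hsum s).hasSum.mul_left _)
    simp only
    rw [(hsum u).tsum_eq_zero_add]
    congr 1
    exact h.tsum_eq

/-! ### Comparison for Volterra inequalities -/

/-- Comparison principle: a subsolution of the Volterra equation `x = s + K * x` on `[0, b]` lies
below the solution `s + r * s`, where `r` is the resolvent of `K`. The difference is a subsolution
of the homogeneous equation, and its maximum cannot be positive because `K` has `L¹` norm less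
than one. -/
lemma le_add_resolvent_of_le_volterra {K r x s : ℝ → ℝ} {q b : ℝ} (hK : Continuous K)
    (hKn : ∀ u, 0 ≤ K u) (hq : q < 1) (hKq : ∀ u, 0 ≤ u → ∫ v in (0 : ℝ)..u, K v ≤ q)
    (hr : Continuous r) (hr0 : ∀ u ≤ 0, r u = 0)
    (hres : ∀ u, 0 ≤ u → r u = K u + volterraConv K r u)
    (hx : Continuous x) (hs : Continuous s)
    (hle : ∀ t ∈ Icc 0 b, x t ≤ s t + volterraConv K x t) :
    ∀ t ∈ Icc 0 b, x t ≤ s t + volterraConv r s t := by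
  have hrs := continuous_volterraConv hr hs
  have hy : ∀ t, 0 ≤ t →
      volterraConv r s t = volterraConv K (fun u => s u + volterraConv r s u) t := by
    intro t ht
    have hKr := continuous_volterraConv hK hr
    rw [volterraConv_add_right hK hs hrs, volterraConv_assoc hK hr hs hr0 ht]
    rw [← volterraConv_add_left hK hKr hs]
    refine intervalIntegral.integral_congr fun u hu => ?_
    rw [uIcc_of_le ht] at hu
    simp only
    rw [hres (t - u) (by linarith [hu.2])]
  set z : ℝ → ℝ := fun u => x u - (s u + volterraConv r s u) with hz
  have hzc : Continuous z := by fun_prop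
  have hzle : ∀ t ∈ Icc 0 b, z t ≤ volterraConv K z t := by
    intro t ht
    have h1 : volterraConv K x t =
        volterraConv K z t + volterraConv K (fun u => s u + volterraConv r s u) t := by
      rw [← volterraConv_add_right hK hzc (by fun_prop)]
      simp [hz]
    have h2 := hle t ht
    have h3 := hy t ht.1
    simp only [hz] at h1 ⊢
    linarith
  intro t ht
  obtain ⟨m, hm, hmax⟩ := isCompact_Icc.exists_isMaxOn ⟨t, ht⟩ hzc.continuousOn
  have hzm : z m ≤ 0 := by
    by_contra! hpos
    have h1 : volterraConv K z m ≤ ∫ u in (0 : ℝ)..m, K (m - u) * z m :=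
      intervalIntegral.integral_mono_on hm.1 (Continuous.intervalIntegrable (by fun_prop) _ _)
        (Continuous.intervalIntegrable (by fun_prop) _ _) fun u hu =>
        mul_le_mul_of_nonneg_left (hmax ⟨hu.1, hu.2.trans hm.2⟩) (hKn _)
    rw [intervalIntegral.integral_mul_const, intervalIntegral.integral_comp_sub_left] at h1
    simp only [sub_self, sub_zero] at h1
    nlinarith [hKq m hm.1, hzle m hm]
  have : z t ≤ 0 := (hmax ht).trans hzm
  simp only [hz] at this
  linarith

/-! ### `L¹` bounds on the kernel -/

/-- The Penrose condition on the half-line `[0, ∞)` bounds the `L¹` norm of a nonnegative kernel: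
its Laplace transform is continuous, tends to `0` at infinity and omits the value `1`, so that it
stays below `1`. -/
lemma integral_le_of_laplace_ne_one {K : ℝ → ℝ} (hK : Continuous K) (hKn : ∀ u, 0 ≤ K u)
    {M b κ : ℝ} (hb : 0 < b) (hKM : ∀ u, 0 ≤ u → K u ≤ M * Real.exp (-b * u)) (hκ : 0 < κ)
    (hP : ∀ x : ℝ, 0 ≤ x → κ ≤ |1 - ∫ s in Ioi (0 : ℝ), Real.exp (-x * s) * K s|) :
    ∫ s in Ioi (0 : ℝ), K s ≤ 1 - κ := by
  set F : ℝ → ℝ := fun x => ∫ s in Ioi (0 : ℝ), Real.exp (-x * s) * K s with hF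
  have hint : IntegrableOn (fun s => M * Real.exp (-b * s)) (Ioi 0) :=
    (integrableOn_exp_mul_Ioi (neg_lt_zero.2 hb) 0).const_mul M
  have hmeas : ∀ x : ℝ, AEStronglyMeasurable (fun s => Real.exp (-x * s) * K s)
      (volume.restrict (Ioi 0)) := fun x => Continuous.aestronglyMeasurable (by fun_prop)
  have hbd : ∀ x : ℝ, 0 ≤ x → ∀ᵐ s ∂(volume.restrict (Ioi (0 : ℝ))),
      ‖Real.exp (-x * s) * K s‖ ≤ M * Real.exp (-b * s) := by
    intro x hx
    refine (ae_restrict_iff' measurableSet_Ioi).2 (.of_forall fun s hs => ?_)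
    have hs' : 0 < s := hs
    rw [Real.norm_of_nonneg (mul_nonneg (Real.exp_nonneg _) (hKn s))]
    refine le_trans (mul_le_of_le_one_left (hKn s) ?_) (hKM s hs'.le)
    exact Real.exp_le_one_iff.2 (by nlinarith)
  have hFc : ContinuousOn F (Ici 0) :=
    continuousOn_of_dominated (fun x _ => hmeas x) (fun x hx => hbd x hx) hint
      (.of_forall fun s => by fun_prop)
  have hFlim : Filter.Tendsto F Filter.atTop (nhds 0) := by
    have h := tendsto_integral_filter_of_dominated_convergence
      (μ := volume.restrict (Ioi (0 : ℝ))) (l := Filter.atTop)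
      (F := fun x s => Real.exp (-x * s) * K s) (f := fun _ => 0) _ (.of_forall hmeas)
      ((Filter.eventually_ge_atTop 0).mono hbd) hint
      ((ae_restrict_iff' measurableSet_Ioi).2 (.of_forall fun s hs => by
        have h1 : Filter.Tendsto (fun x : ℝ => -x * s) Filter.atTop Filter.atBot :=
          Filter.tendsto_neg_atTop_atBot.atBot_mul_const hs
        simpa using (Real.tendsto_exp_atBot.comp h1).mul_const (K s)))
    rwa [integral_zero] at h
  have hF0 : F 0 = ∫ s in Ioi (0 : ℝ), K s := by simp [hF]
  rw [← hF0]
  by_contra! hlt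
  have h1 : 1 < F 0 := by
    rcases le_abs.1 (hP 0 le_rfl) with h | h <;> simp only [hF] at hlt ⊢ <;> linarith
  obtain ⟨X, hX1, hX0⟩ :=
    ((hFlim.eventually (gt_mem_nhds one_pos)).and (Filter.eventually_ge_atTop 0)).exists
  obtain ⟨y, hy, hy1⟩ := intermediate_value_Icc' hX0 (hFc.mono Icc_subset_Ici_self)
    ⟨hX1.le, h1.le⟩
  have h2 := hP y hy.1
  simp only [hF] at hy1
  rw [hy1] at h2
  simp at h2
  linarith

/-- In this and the next lemma `n` stands for `|k|`; the bounds are uniform in `n ≥ 1`. -/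
lemma le_exp_of_le_mul_exp {K : ℝ → ℝ} {A n θ₀ θ : ℝ} (hA : 0 ≤ A) (hn : 1 ≤ n) (hθ₀ : 0 < θ₀)
    (hθ : θ ≤ θ₀ / 2) (hKA : ∀ u, 0 ≤ u → K u ≤ A * (u * Real.exp (-θ₀ * (u * n)))) {u : ℝ}
    (hu : 0 ≤ u) : K u ≤ 2 * A / θ₀ * Real.exp (-(θ * n) * u) := by
  have h1 : u ≤ 2 / θ₀ * Real.exp (θ₀ / 2 * (u * n)) := by
    have h := Real.add_one_le_exp (θ₀ / 2 * (u * n))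
    have h' : u ≤ u * n := le_mul_of_one_le_right hu hn
    rw [div_mul_eq_mul_div, le_div_iff₀ hθ₀]
    nlinarith
  have h2 : Real.exp (θ₀ / 2 * (u * n)) * Real.exp (-θ₀ * (u * n)) ≤
      Real.exp (-(θ * n) * u) := by
    rw [← Real.exp_add]
    refine Real.exp_le_exp.2 ?_
    have : 0 ≤ u * n := by positivity
    nlinarith
  calc K u ≤ A * (u * Real.exp (-θ₀ * (u * n))) := hKA u hu
    _ ≤ A * (2 / θ₀ * Real.exp (θ₀ / 2 * (u * n)) * Real.exp (-θ₀ * (u * n))) := by gcongr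
    _ = 2 * A / θ₀ * (Real.exp (θ₀ / 2 * (u * n)) * Real.exp (-θ₀ * (u * n))) := by ring
    _ ≤ _ := by gcongr

/-- Passing to the weight `e^{θ n u}` increases the `L¹` norm of the kernel by `O(θ)`. -/
lemma integral_mul_exp_le {K : ℝ → ℝ} (hK : Continuous K) (hKn : ∀ u, 0 ≤ K u)
    {A n θ₀ θ q : ℝ} (hA : 0 ≤ A) (hn : 1 ≤ n) (hθ₀ : 0 < θ₀) (hθpos : 0 ≤ θ) (hθ : θ ≤ θ₀ / 2)
    (hKA : ∀ u, 0 ≤ u → K u ≤ A * (u * Real.exp (-θ₀ * (u * n))))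
    (hKi : IntegrableOn K (Ioi 0)) (hq : ∫ v in Ioi (0 : ℝ), K v ≤ q) {u : ℝ} (hu : 0 ≤ u) :
    ∫ v in (0 : ℝ)..u, K v * Real.exp (θ * n * v) ≤ q + 256 * A * θ / θ₀ ^ 3 := by
  have hpt : ∀ v, 0 ≤ v → K v * Real.exp (θ * n * v) ≤
      K v + 64 * A * θ / θ₀ ^ 2 * Real.exp (-(θ₀ / 4) * v) := by
    intro v hv
    set w := v * n with hw
    have hw0 : 0 ≤ w := by positivity
    have hvw : v ≤ w := le_mul_of_one_le_right hv hn
    -- `e^x ≤ 1 + x e^x`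
    have h1 : Real.exp (θ * w) ≤ 1 + θ * w * Real.exp (θ * w) := by
      have h := Real.add_one_le_exp (-(θ * w))
      have h' : Real.exp (-(θ * w)) * Real.exp (θ * w) = 1 := by
        rw [← Real.exp_add]
        simp
      nlinarith [Real.exp_pos (θ * w)]
    have h2 : w * w ≤ 64 / θ₀ ^ 2 * Real.exp (θ₀ / 4 * w) := by
      have h := Real.add_one_le_exp (θ₀ / 8 * w)
      have h' : Real.exp (θ₀ / 4 * w) = Real.exp (θ₀ / 8 * w) * Real.exp (θ₀ / 8 * w) := by
        rw [← Real.exp_add]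
        congr 1
        ring
      have h3 : θ₀ / 8 * w * (θ₀ / 8 * w) ≤ Real.exp (θ₀ / 4 * w) := by
        rw [h']
        exact mul_self_le_mul_self (by positivity) (by linarith)
      rw [div_mul_eq_mul_div, le_div_iff₀ (by positivity)]
      nlinarith
    have h3 : Real.exp (θ₀ / 4 * w) * Real.exp (-θ₀ * w) * Real.exp (θ * w) ≤
        Real.exp (-(θ₀ / 4) * v) := by
      rw [← Real.exp_add, ← Real.exp_add]
      refine Real.exp_le_exp.2 ?_
      nlinarith
    have he : θ * n * v = θ * w := by
      rw [hw]
      ring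
    rw [he]
    calc K v * Real.exp (θ * w)
        ≤ K v * (1 + θ * w * Real.exp (θ * w)) := mul_le_mul_of_nonneg_left h1 (hKn v)
      _ = K v + K v * (θ * w * Real.exp (θ * w)) := by ring
      _ ≤ K v + A * (v * Real.exp (-θ₀ * w)) * (θ * w * Real.exp (θ * w)) := by
          gcongr
          exact hKA v hv
      _ = K v + A * θ * (v * w * (Real.exp (-θ₀ * w) * Real.exp (θ * w))) := by ring
      _ ≤ K v + A * θ * (64 / θ₀ ^ 2 * Real.exp (θ₀ / 4 * w) *
            (Real.exp (-θ₀ * w) * Real.exp (θ * w))) := by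
          have h4 := (mul_le_mul_of_nonneg_right hvw hw0).trans h2
          gcongr K v + A * θ * (?_ * _)
      _ = K v + 64 * A * θ / θ₀ ^ 2 *
            (Real.exp (θ₀ / 4 * w) * Real.exp (-θ₀ * w) * Real.exp (θ * w)) := by ring
      _ ≤ _ := by gcongr
  have hei : IntegrableOn (fun v => 64 * A * θ / θ₀ ^ 2 * Real.exp (-(θ₀ / 4) * v)) (Ioi 0) :=
    (integrableOn_exp_mul_Ioi (by linarith) 0).const_mul _
  calc ∫ v in (0 : ℝ)..u, K v * Real.exp (θ * n * v)
      ≤ ∫ v in (0 : ℝ)..u, (K v + 64 * A * θ / θ₀ ^ 2 * Real.exp (-(θ₀ / 4) * v)) :=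
        intervalIntegral.integral_mono_on hu (Continuous.intervalIntegrable (by fun_prop) _ _)
          (Continuous.intervalIntegrable (by fun_prop) _ _) fun v hv => hpt v hv.1
    _ ≤ ∫ v in Ioi (0 : ℝ), (K v + 64 * A * θ / θ₀ ^ 2 * Real.exp (-(θ₀ / 4) * v)) := by
        rw [intervalIntegral.integral_of_le hu]
        exact setIntegral_mono_set (hKi.add hei)
          (.of_forall fun v => add_nonneg (hKn v) (by positivity))
          Ioc_subset_Ioi_self.eventuallyLE
    _ = (∫ v in Ioi (0 : ℝ), K v) + 256 * A * θ / θ₀ ^ 3 := by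
        rw [integral_add hKi hei, integral_const_mul, integral_exp_mul_Ioi (by linarith)]
        congr 1
        simp
        field_simp
        ring
    _ ≤ _ := by gcongr

/-! ### The majorant kernel of a density mode -/

lemma continuous_fourierHat {d : ℕ} {μ : EuclideanSpace ℝ (Fin d) → ℝ} (hμ : Integrable μ) :
    Continuous (fourierHat μ) := by
  refine continuous_of_dominated (bound := fun w => ‖μ w‖) (fun ξ => ?_) (fun ξ => ?_) hμ.norm
    (.of_forall fun w => by fun_prop)
  · exact (Complex.continuous_ofReal.comp_aestronglyMeasurable hμ.1).mul
      (Continuous.aestronglyMeasurable (by fun_prop))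
  · refine .of_forall fun w => ?_
    simp [Complex.norm_exp]

lemma one_le_norm_freqVec {d : ℕ} {k : Fin d → ℤ} (hk : k ≠ 0) : 1 ≤ ‖freqVec k‖ := by
  obtain ⟨i, hi⟩ := Function.ne_iff.1 hk
  refine le_trans ?_ (PiLp.norm_apply_le (freqVec k) i)
  simp only [freqVec, Real.norm_eq_abs]
  exact_mod_cast Int.one_le_abs hi

/-- The profile `u ↦ 4π a(t₀)^{4-d} u |μ̂(uk)|` of the convolution kernel `majorantKernel`,
extended by zero to `u < 0`. -/
noncomputable def majorantProfile {d : ℕ} (μ : EuclideanSpace ℝ (Fin d) → ℝ) (a : ℝ → ℝ) (t₀ : ℝ)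
    (k : Fin d → ℤ) (u : ℝ) : ℝ :=
  4 * Real.pi * (a t₀) ^ ((4 : ℤ) - (d : ℤ)) * (max u 0 * ‖fourierHat μ (u • freqVec k)‖)

lemma majorantKernel_eq_majorantProfile {d : ℕ} (μ : EuclideanSpace ℝ (Fin d) → ℝ) (a : ℝ → ℝ)
    (t₀ : ℝ) (k : Fin d → ℤ) {τ σ : ℝ} (h : σ ≤ τ) :
    majorantKernel μ a t₀ k τ σ = majorantProfile μ a t₀ k (τ - σ) := by
  rw [majorantKernel, majorantProfile, max_eq_left (sub_nonneg.2 h)]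

lemma continuous_majorantProfile {d : ℕ} {μ : EuclideanSpace ℝ (Fin d) → ℝ} (hμ : Integrable μ)
    (a : ℝ → ℝ) (t₀ : ℝ) (k : Fin d → ℤ) : Continuous (majorantProfile μ a t₀ k) := by
  have := continuous_fourierHat hμ
  unfold majorantProfile
  fun_prop

lemma majorantProfile_of_nonpos {d : ℕ} (μ : EuclideanSpace ℝ (Fin d) → ℝ) (a : ℝ → ℝ)
    (t₀ : ℝ) (k : Fin d → ℤ) {u : ℝ} (hu : u ≤ 0) : majorantProfile μ a t₀ k u = 0 := by
  simp [majorantProfile, max_eq_right hu]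

lemma majorantProfile_nonneg {d : ℕ} (μ : EuclideanSpace ℝ (Fin d) → ℝ) {a : ℝ → ℝ} {t₀ : ℝ}
    (ha : 0 < a t₀) (k : Fin d → ℤ) (u : ℝ) : 0 ≤ majorantProfile μ a t₀ k u := by
  unfold majorantProfile
  positivity

lemma majorantProfile_le {d : ℕ} {μ : EuclideanSpace ℝ (Fin d) → ℝ} {C₀ θ₀ : ℝ}
    (hμ : IsBackground μ C₀ θ₀) {a : ℝ → ℝ} {t₀ : ℝ} (ha : 0 < a t₀) (k : Fin d → ℤ) {u : ℝ}
    (hu : 0 ≤ u) :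
    majorantProfile μ a t₀ k u ≤ 4 * Real.pi * (a t₀) ^ ((4 : ℤ) - (d : ℤ)) * C₀ *
      (u * Real.exp (-θ₀ * (u * ‖freqVec k‖))) := by
  have h := hμ.decay (u • freqVec k)
  rw [norm_smul, Real.norm_of_nonneg hu] at h
  rw [majorantProfile, max_eq_left hu]
  calc _ ≤ 4 * Real.pi * (a t₀) ^ ((4 : ℤ) - (d : ℤ)) *
        (u * (C₀ * Real.exp (-θ₀ * (u * ‖freqVec k‖)))) := by gcongr
    _ = _ := by ring

lemma AdaptedPenrose.le_abs_laplace {d : ℕ} {μ : EuclideanSpace ℝ (Fin d) → ℝ} {a : ℝ → ℝ}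
    {t₀ κ : ℝ} (hP : AdaptedPenrose μ a t₀ κ) {k : Fin d → ℤ} (hk : k ≠ 0) {x : ℝ}
    (hx : 0 ≤ x) :
    κ ≤ |1 - ∫ s in Ioi (0 : ℝ), Real.exp (-x * s) * majorantProfile μ a t₀ k s| := by
  have h := hP k hk (x : ℂ) (by simpa using hx)
  have h1 : ∫ s in Ioi (0 : ℝ), Complex.exp (-(x : ℂ) * (s : ℂ)) *
        ((s * ‖fourierHat μ (s • freqVec k)‖ : ℝ) : ℂ) =
      ((∫ s in Ioi (0 : ℝ), Real.exp (-x * s) * (s * ‖fourierHat μ (s • freqVec k)‖) : ℝ) : ℂ) := by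
    refine Eq.trans ?_ integral_complex_ofReal
    simp
  have h2 : ∫ s in Ioi (0 : ℝ), Real.exp (-x * s) * majorantProfile μ a t₀ k s =
      4 * Real.pi * (a t₀) ^ (-((d : ℤ) - 4)) *
        ∫ s in Ioi (0 : ℝ), Real.exp (-x * s) * (s * ‖fourierHat μ (s • freqVec k)‖) := by
    rw [← integral_const_mul]
    refine setIntegral_congr_fun measurableSet_Ioi fun s hs => ?_
    have hs' : 0 ≤ s := le_of_lt hs
    simp only [majorantProfile, max_eq_left hs', neg_sub]
    ring
  rw [h1, ← Complex.ofReal_mul, ← Complex.ofReal_one, ← Complex.ofReal_sub, Complex.norm_real,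
    Real.norm_eq_abs] at h
  rwa [h2]

/-! ### The Volterra equation of a density mode -/

lemma IsScaleFactor.le_of_mem_range {a : ℝ → ℝ} (ha : IsScaleFactor a) {t₀ t : ℝ} (ht₀ : 0 < t₀)
    (ht : t₀ ≤ t) {σ : ℝ} (hσ : σ ∈ Icc 0 (tauOf a t₀ t)) : a t₀ ≤ a (timeOf a t₀ σ) := by
  have hc : ContinuousOn (tauOf a t₀) (Icc t₀ t) := by
    rw [← uIcc_of_le ht]
    refine intervalIntegral.continuousOn_primitive_interval ?_
    rw [uIcc_of_le ht]
    refine ContinuousOn.integrableOn_Icc (ContinuousOn.zpow₀ (ha.smooth.continuousOn.mono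
      fun s hs => ht₀.trans_le hs.1) _ fun s hs => .inl (ha.pos s (ht₀.trans_le hs.1)).ne')
  obtain ⟨s, hs, hsσ⟩ := intermediate_value_Icc ht hc
    (show σ ∈ Icc (tauOf a t₀ t₀) (tauOf a t₀ t) by simpa [tauOf] using hσ)
  have h : t₀ ≤ timeOf a t₀ σ := Function.invFunOn_mem ⟨s, hs.1, hsσ⟩
  exact ha.mono ht₀ (ht₀.trans_le h) h

/-- Solutions of the Volterra equation of the density mode are subsolutions of the majorant
equation: as `4 - d < 0`, replacing `a(T(σ))` by the smaller `a(t₀)` increases the kernel. -/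
lemma SolvesVolterra.norm_le {d : ℕ} (hd : 5 ≤ d) {a : ℝ → ℝ} (ha : IsScaleFactor a)
    {t₀ t : ℝ} (ht₀ : 0 < t₀) (ht : t₀ ≤ t) {μ : EuclideanSpace ℝ (Fin d) → ℝ}
    (hμ : Integrable μ) {ε : ℝ} (hε : ε = 1 ∨ ε = -1) {k : Fin d → ℤ} {S ρ : ℝ → ℂ}
    (h : SolvesVolterra μ a t₀ ε k (tauOf a t₀ t) S ρ) {x : ℝ → ℝ} (hx : Continuous x)
    (hxρ : ∀ σ ∈ Icc 0 (tauOf a t₀ t), x σ = ‖ρ σ‖) {τ : ℝ}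
    (hτ : τ ∈ Icc 0 (tauOf a t₀ t)) :
    ‖ρ τ‖ ≤ ‖S τ‖ + volterraConv (majorantProfile μ a t₀ k) x τ := by
  have hK := continuous_majorantProfile hμ a t₀ k
  have hε' : |ε| = 1 := by rcases hε with rfl | rfl <;> simp
  rw [h τ hτ, ← intervalIntegral.integral_const_mul]
  refine (norm_add_le _ _).trans ?_
  gcongr
  refine intervalIntegral.norm_integral_le_of_norm_le hτ.1 (.of_forall fun σ hσ => ?_)
    (Continuous.intervalIntegrable (by fun_prop) _ _)
  have hσ' : σ ∈ Icc 0 (tauOf a t₀ t) := ⟨hσ.1.le, hσ.2.trans hτ.2⟩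
  have hpos := ha.pos t₀ ht₀
  have hle := ha.le_of_mem_range ht₀ ht hσ'
  have hpow : (a (timeOf a t₀ σ)) ^ ((4 : ℤ) - (d : ℤ)) ≤ (a t₀) ^ ((4 : ℤ) - (d : ℤ)) := by
    obtain ⟨m, rfl⟩ := Nat.exists_eq_add_of_le (show 4 ≤ d by omega)
    have : (4 : ℤ) - ((4 + m : ℕ) : ℤ) = -(m : ℤ) := by
      push_cast
      ring
    rw [this, zpow_neg, zpow_neg, zpow_natCast, zpow_natCast]
    gcongr
  have hτσ : 0 ≤ τ - σ := sub_nonneg.2 hσ.2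
  simp only [norm_mul, Complex.norm_real, Real.norm_eq_abs, hε', hxρ σ hσ', majorantProfile,
    max_eq_left hτσ, abs_of_nonneg hτσ, abs_of_pos Real.pi_pos, abs_zpow,
    abs_of_pos (hpos.trans_le hle), Nat.abs_ofNat]
  calc _ = 4 * Real.pi * ((τ - σ) * ‖fourierHat μ ((τ - σ) • freqVec k)‖) * ‖ρ σ‖ *
        (a (timeOf a t₀ σ)) ^ ((4 : ℤ) - (d : ℤ)) := by ring
    _ ≤ 4 * Real.pi * ((τ - σ) * ‖fourierHat μ ((τ - σ) • freqVec k)‖) * ‖ρ σ‖ *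
        (a t₀) ^ ((4 : ℤ) - (d : ℤ)) := by gcongr
    _ = _ := by ring

/-! ### Pointwise damping -/

theorem corollaryB5 (d : ℕ) (hd : 5 ≤ d)
    (a : ℝ → ℝ) (ha : IsScaleFactor a) (t₀ : ℝ) (ht₀ : 0 < t₀)
    (μ : EuclideanSpace ℝ (Fin d) → ℝ) (C₀ θ₀ κ : ℝ) (hθ₀ : 0 < θ₀) (hκ : 0 < κ)
    (hμ : IsBackground μ C₀ θ₀) (hP : AdaptedPenrose μ a t₀ κ) :
    ∃ θ₁ : ℝ, 0 < θ₁ ∧ ∃ C : ℝ, 0 < C ∧ ∃ R : (Fin d → ℤ) → ℝ → ℝ → ℝ,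
      ∀ k : Fin d → ℤ, k ≠ 0 →
        IsResolventKernel (majorantKernel μ a t₀ k) (R k) ∧
        (∀ τ σ : ℝ, 0 ≤ σ → σ ≤ τ →
          0 ≤ R k τ σ ∧ |R k τ σ| ≤ C * Real.exp (-θ₁ * ‖freqVec k‖ * (τ - σ))) ∧
        (∀ ε : ℝ, (ε = 1 ∨ ε = -1) → ∀ t : ℝ, t₀ ≤ t → ∀ S ρ : ℝ → ℂ,
          ContinuousOn S (Icc 0 (tauOf a t₀ t)) → ContinuousOn ρ (Icc 0 (tauOf a t₀ t)) →
          SolvesVolterra μ a t₀ ε k (tauOf a t₀ t) S ρ →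
          ∀ τ ∈ Icc (0 : ℝ) (tauOf a t₀ t),
            ‖ρ τ‖ ≤ ‖S τ‖ + ∫ σ in (0 : ℝ)..τ, R k τ σ * ‖S σ‖) := by
  have hpos := ha.pos t₀ ht₀
  have hC₀ : 0 ≤ C₀ := by
    have h := (norm_nonneg _).trans (hμ.decay 0)
    simpa using h
  obtain ⟨A, hAdef⟩ : ∃ A, A = 4 * Real.pi * (a t₀) ^ ((4 : ℤ) - (d : ℤ)) * C₀ := ⟨_, rfl⟩
  have hA : 0 ≤ A := by
    rw [hAdef]
    positivity
  -- The second bound on `θ` makes the weight cost at most `κ / 2` in the `L¹` norm.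
  obtain ⟨θ, hθdef⟩ : ∃ θ, θ = min (θ₀ / 2) (κ * θ₀ ^ 3 / (512 * (A + 1))) := ⟨_, rfl⟩
  have hθpos : 0 < θ := by
    rw [hθdef]
    positivity
  have hθ2 : θ ≤ θ₀ / 2 := hθdef ▸ min_le_left _ _
  have hθκ : 256 * A * θ / θ₀ ^ 3 ≤ κ / 2 := by
    have h : θ ≤ κ * θ₀ ^ 3 / (512 * (A + 1)) := hθdef ▸ min_le_right _ _
    rw [le_div_iff₀ (by positivity)] at h
    rw [div_le_iff₀ (by positivity)]
    nlinarith
  have key : ∀ k : Fin d → ℤ, ∃ r : ℝ → ℝ, k ≠ 0 →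
      (∀ u, 0 ≤ u → ∫ v in (0 : ℝ)..u, majorantProfile μ a t₀ k v ≤ 1 - κ / 2) ∧
      Continuous r ∧ (∀ u ≤ 0, r u = 0) ∧ (∀ u, 0 ≤ r u) ∧
      (∀ u, 0 ≤ u →
        r u ≤ 2 * A / θ₀ / (1 - (1 - κ / 2)) * Real.exp (-(θ * ‖freqVec k‖) * u)) ∧
      ∀ u, 0 ≤ u → r u = majorantProfile μ a t₀ k u +
        volterraConv (majorantProfile μ a t₀ k) r u := by
    intro k
    by_cases hk : k = 0
    · exact ⟨0, fun h => absurd hk h⟩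
    have hn := one_le_norm_freqVec hk
    have hK := continuous_majorantProfile hμ.integrable a t₀ k
    have hKn := majorantProfile_nonneg μ hpos k
    have hKA : ∀ u, 0 ≤ u → majorantProfile μ a t₀ k u ≤
        A * (u * Real.exp (-θ₀ * (u * ‖freqVec k‖))) := fun u hu =>
      hAdef ▸ majorantProfile_le hμ hpos k hu
    have hKM := fun u (hu : 0 ≤ u) => le_exp_of_le_mul_exp hA hn hθ₀ hθ2 hKA hu
    have hb : 0 < θ * ‖freqVec k‖ := by positivity
    have hq := integral_le_of_laplace_ne_one hK hKn hb hKM hκ fun x hx => hP.le_abs_laplace hk hx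
    have hKi : IntegrableOn (majorantProfile μ a t₀ k) (Ioi 0) := by
      refine Integrable.mono' ((integrableOn_exp_mul_Ioi (neg_lt_zero.2 hb) 0).const_mul
        (2 * A / θ₀)) hK.aestronglyMeasurable
        ((ae_restrict_iff' measurableSet_Ioi).2 (.of_forall fun u hu => ?_))
      rw [Real.norm_of_nonneg (hKn u)]
      exact hKM u (le_of_lt hu)
    have hI : 0 ≤ ∫ v in Ioi (0 : ℝ), majorantProfile μ a t₀ k v := integral_nonneg hKn
    obtain ⟨r, hr⟩ := exists_convolution_resolvent hK
      (fun u hu => majorantProfile_of_nonpos μ a t₀ k hu) hKn hb.le hKM (by positivity)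
      (show 0 ≤ 1 - κ / 2 by linarith) (by linarith) fun u hu =>
        (integral_mul_exp_le hK hKn hA hn hθ₀ hθpos.le hθ2 hKA hKi hq hu).trans (by linarith)
    refine ⟨r, fun _ => ⟨fun u hu => ?_, hr⟩⟩
    rw [intervalIntegral.integral_of_le hu]
    have := setIntegral_mono_set hKi (.of_forall hKn)
      (show Ioc 0 u ⊆ Ioi 0 from Ioc_subset_Ioi_self).eventuallyLE
    linarith
  choose r hr using key
  refine ⟨θ, hθpos, 2 * A / θ₀ / (1 - (1 - κ / 2)) + 1, ?_, fun k τ σ => r k (τ - σ),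
    fun k hk => ?_⟩
  · have : 0 < 1 - (1 - κ / 2) := by linarith
    positivity
  obtain ⟨hKq, hrc, hr0, hrn, hrle, hres⟩ := hr k hk
  have hK := continuous_majorantProfile hμ.integrable a t₀ k
  refine ⟨⟨by fun_prop, fun τ σ _ hστ => ?_⟩, fun τ σ _ hστ => ⟨hrn _, ?_⟩, ?_⟩
  · simp only
    rw [hres _ (sub_nonneg.2 hστ), majorantKernel_eq_majorantProfile _ _ _ _ hστ,
      ← intervalIntegral_shift_eq_volterraConv]
    congr 1
    refine intervalIntegral.integral_congr fun s hs => ?_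
    rw [uIcc_of_le hστ] at hs
    rw [majorantKernel_eq_majorantProfile _ _ _ _ hs.2]
  · rw [abs_of_nonneg (hrn _), neg_mul]
    refine (hrle _ (sub_nonneg.2 hστ)).trans ?_
    gcongr
    linarith
  · intro ε hε t ht S ρ hS hρ hsol τ hτ
    have hb : 0 ≤ tauOf a t₀ t := hτ.1.trans hτ.2
    -- `‖S‖` and `‖ρ‖` are only continuous on `[0, τ(t)]` and are extended by constants.
    have hext : ∀ f : ℝ → ℂ, ContinuousOn f (Icc 0 (tauOf a t₀ t)) →
        ∃ x : ℝ → ℝ, Continuous x ∧ ∀ σ ∈ Icc 0 (tauOf a t₀ t), x σ = ‖f σ‖ := fun f hf =>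
      ⟨IccExtend hb ((Icc 0 (tauOf a t₀ t)).domRestrict fun σ => ‖f σ‖),
        (continuousOn_iff_continuous_domRestrict.1 hf.norm).Icc_extend',
        fun σ hσ => IccExtend_of_mem hb _ hσ⟩
    obtain ⟨s, hsc, hs⟩ := hext S hS
    obtain ⟨x, hxc, hx⟩ := hext ρ hρ
    have h := le_add_resolvent_of_le_volterra hK (majorantProfile_nonneg μ hpos k)
      (show 1 - κ / 2 < 1 by linarith) hKq hrc hr0 hres hxc hsc (fun σ hσ => by
        rw [hx σ hσ, hs σ hσ]
        exact hsol.norm_le hd ha ht₀ ht hμ.integrable hε hxc hx hσ) τ hτ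
    rw [hx τ hτ, hs τ hτ] at h
    refine h.trans_eq ?_
    congr 1
    refine intervalIntegral.integral_congr fun σ hσ => ?_
    rw [uIcc_of_le hτ.1] at hσ
    simp only
    rw [hs σ ⟨hσ.1, hσ.2.trans hτ.2⟩]
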